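/- Let $X$ be a finite nonempty set. An association scheme on $X$ is a partition $S$ of $X\times X$ such that $1_X=\{(x,x)\mid x\in X\}\in S$; $s^*=\{(y,x)\mid (x,y)\in s\}\in S$ for every $s\in S$; and for all $s,t,u\in S$ the number $a_{stu}=|\{z\in X\mid (x,z)\in s,\ (z,y)\in t\}|$ does not depend on the choice of $(x,y)\in u$. The valency of $s$ is $n_s=a_{ss^*1_X}$, and the order of $U\subseteq S$ is $n_U=\sum_{u\in U}n_u$. The scheme is commutative if $a_{stu}=a_{tsu}$ for all $s,t,u\in S$, and it is a $p$-scheme if all valencies and $|X|$ are powers of the prime $p$. For $P,Q\subseteq S$ let $PQ=\{s\in S\mid a_{pqs}\neq 0\text{ for some }p\in P,\ q\in Q\}$. A nonempty $T\subseteq S$ is closed if $TT\subseteq T$, and a closed $T$ is strongly normal if $s^*Ts\subseteq T$ for all $s\in S$. The thin radical is $O_\theta(S)=\{s\in S\mid n_s=1\}$, and the thin residue $O^\theta(S)$ is the intersection of all strongly normal closed subsets of $S$. For closed $T$ put $xT=\{y\in X\mid (x,y)\in t\text{ for some }t\in T\}$ (and likewise $xU$ for any $U\subseteq S$); the quotient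 scheme $S/\!/T$ on $X/T=\{xT\mid x\in X\}$ consists of the relations $s^T=\{(xT,yT)\mid y\in xTsT\}$, $s\in S$. Write $C_n$ for the scheme on $\mathbb Z/n\mathbb Z$ with relations $\{(a,b)\mid b-a=g\}$, $g\in\mathbb Z/n\mathbb Z$. Two schemes are isomorphic if there are a bijection $\varphi$ between their point sets and a bijection $\psi$ between their sets of relations such that $(x,y)\in s$ implies $(\varphi(x),\varphi(y))\in\psi(s)$. The scheme $S$ is schurian if it is the set of orbits on $X\times X$, under the componentwise action, of a transitive permutation group on $X$. **Theorem.** Let $p$ be an odd prime and let $S$ be a commutative $p$-scheme of order $n_S=p^4$. Assume that one of the following conditions holds. 1. $O^\theta(S)=O_\theta(S)$, $n_{O_\theta(S)}=p^2$ and $S/\!/O^\theta(S)\cong C_{p^2}$. 2. $n_{O_\theta(S)}=n_{O^\theta(S)}=p^2$, $O^\theta(S)\neq O_\theta(S)$, and $n_s=p^2$ for each $s\in S\setminus O_\theta(S)O^\theta(S)$. 3. $n_{O_\theta(S)}=p^3$. Then $S$ is schurian. -/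

import Mathlib

/-- An association scheme on a finite set `X`: a partition of `X × X` containing the diagonal,
closed under transposition, and with constant intersection numbers.
Since the diagonal is a block of a partition, `X` is automatically nonempty. -/
structure AssocScheme (X : Type*) [Finite X] where
  /-- the set of relations of the scheme -/
  rels : Set (Set (X × X))
  isPartition : Setoid.IsPartition rels
  diag_mem : Set.diagonal X ∈ rels
  transpose_mem : ∀ s ∈ rels, Prod.swap ⁻¹' s ∈ rels
  regular : ∀ s ∈ rels, ∀ t ∈ rels, ∀ u ∈ rels, ∀ x y x' y' : X, (x, y) ∈ u → (x', y') ∈ u →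
    Set.ncard {z : X | (x, z) ∈ s ∧ (z, y) ∈ t} = Set.ncard {z : X | (x', z) ∈ s ∧ (z, y') ∈ t}

namespace AssocScheme

section Basic

variable {X : Type*} [Finite X] (S : AssocScheme X)

/-- The elements of the scheme, as a type. -/
abbrev Rel : Type _ := {s : Set (X × X) // s ∈ S.rels}

/-- The diagonal relation `1_X`. -/
def one : S.Rel := ⟨Set.diagonal X, S.diag_mem⟩

/-- The transposed relation `s^*`. -/
def star (s : S.Rel) : S.Rel := ⟨Prod.swap ⁻¹' s.1, S.transpose_mem s.1 s.2⟩

theorem rel_nonempty (u : S.Rel) : u.1.Nonempty :=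
  Setoid.nonempty_of_mem_partition S.isPartition u.2

/-- The intersection number `a_{stu} = |xs ∩ yt^*|`, computed at some pair `(x, y) ∈ u`. -/
noncomputable def inter (s t u : S.Rel) : ℕ :=
  Set.ncard {z : X | ((S.rel_nonempty u).some.1, z) ∈ s.1 ∧ (z, (S.rel_nonempty u).some.2) ∈ t.1}

/-- `a_{stu}` may be computed at every pair `(x, y) ∈ u`. -/
theorem inter_eq (s t u : S.Rel) {x y : X} (h : (x, y) ∈ u.1) :
    S.inter s t u = Set.ncard {z : X | (x, z) ∈ s.1 ∧ (z, y) ∈ t.1} :=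
  S.regular _ s.2 _ t.2 _ u.2 _ _ _ _ (S.rel_nonempty u).some_mem h

/-- The valency `n_s = a_{s s^* 1_X}`. -/
noncomputable def valency (s : S.Rel) : ℕ := S.inter s (S.star s) S.one

/-- The order `n_U`, the sum of the valencies of the elements of `U`. -/
noncomputable def order (U : Set S.Rel) : ℕ := ∑ᶠ u ∈ U, S.valency u

/-- The complex product `PQ`. -/
def complexMul (P Q : Set S.Rel) : Set S.Rel :=
  {s | ∃ p ∈ P, ∃ q ∈ Q, S.inter p q s ≠ 0}

/-- Closed subsets of `S`. -/
def IsClosedSubset (T : Set S.Rel) : Prop :=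
  T.Nonempty ∧ S.complexMul T T ⊆ T

/-- Strongly normal closed subsets: `s^* T s ⊆ T` for every `s`. -/
def IsStronglyNormal (T : Set S.Rel) : Prop :=
  S.IsClosedSubset T ∧ ∀ s : S.Rel, S.complexMul (S.complexMul {S.star s} T) {s} ⊆ T

/-- The thin radical `O_θ(S)`. -/
def thinRadical : Set S.Rel := {s | S.valency s = 1}

/-- The thin residue `O^θ(S)`, the intersection of all strongly normal closed subsets. -/
def thinResidue : Set S.Rel := ⋂₀ {T | S.IsStronglyNormal T}

/-- `xU`, the union of the sets `xu` with `u ∈ U`. -/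
def nbhd (x : X) (U : Set S.Rel) : Set X := {y | ∃ u ∈ U, (x, y) ∈ u.1}

/-- `X / T`, the set of all `xT` with `x ∈ X`. -/
abbrev PointQuotient (T : Set S.Rel) : Type _ :=
  {A : Set X // A ∈ Set.range fun x => S.nbhd x T}

/-- The class `xT` as an element of `X / T`. -/
def toPointQuotient (T : Set S.Rel) (x : X) : S.PointQuotient T := ⟨S.nbhd x T, x, rfl⟩

/-- `s^T`, the set of all `(xT, yT)` with `y ∈ xTsT`. -/
def quotientRel (T : Set S.Rel) (s : S.Rel) : Set (S.PointQuotient T × S.PointQuotient T) :=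
  {q | ∃ x y : X, y ∈ S.nbhd x (S.complexMul (S.complexMul T {s}) T) ∧
    q = (S.toPointQuotient T x, S.toPointQuotient T y)}

/-- The set of relations `S // T` of the quotient scheme on `X / T`. -/
def quotientRels (T : Set S.Rel) : Set (Set (S.PointQuotient T × S.PointQuotient T)) :=
  Set.range (S.quotientRel T)

/-- The scheme is commutative. -/
def IsCommutative : Prop := ∀ s t u : S.Rel, S.inter s t u = S.inter t s u

/-- `S` is a `p`-scheme: all valencies and `|X|` are powers of `p`. -/
def IsPScheme (p : ℕ) : Prop :=
  (∀ s : S.Rel, ∃ k : ℕ, S.valency s = p ^ k) ∧ ∃ k : ℕ, Nat.card X = p ^ k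

/-- `S` is schurian: it is the set of orbits on `X × X`, under the componentwise action, of a
transitive permutation group on `X`. -/
def IsSchurian : Prop :=
  ∃ G : Subgroup (Equiv.Perm X), MulAction.IsPretransitive G X ∧
    S.rels = Set.range fun q : X × X => MulAction.orbit G q

end Basic

/-- Isomorphism of schemes, given by their sets of relations: a bijection between the points and
a bijection between the relations that are compatible. -/
def Isomorphic {X Y : Type*} (R : Set (Set (X × X))) (R' : Set (Set (Y × Y))) : Prop :=
  ∃ (φ : X ≃ Y) (ψ : R ≃ R'), ∀ (s : R) (x y : X), (x, y) ∈ s.1 → (φ x, φ y) ∈ (ψ s).1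

/-- The relations of the thin scheme of the cyclic group `C_n`, which are the sets
`{(a, b) | a + g = b}` for `g ∈ C_n`. -/
def cyclicRels (n : ℕ) : Set (Set (ZMod n × ZMod n)) :=
  Set.range fun g : ZMod n => {q : ZMod n × ZMod n | q.1 + g = q.2}

end AssocScheme

namespace AssocScheme

/-! ### Schemes as colourings of pairs of points; closed subsets and thin relations. -/

section Points

variable {X : Type*} [Finite X] (S : AssocScheme X)

/-! The automorphism group has the relations as its orbits because every relation-preserving map
between sets of points extends one point at a time. To extend it to `y`, pick an anchor `a` in the
domain and place `y'` over the image of `a`. The other relations are then right if each `rel a d` is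
absorbed by `rel d y`, that is, if `s^* s v = {v}`.

By commutativity `s^* s v = {v}` holds as soon as `ker s = s^* s` consists of thin relations and
lies in `ker v` (`IsCommutative.absorbs`). So the hypotheses are used to compare kernels. If the
thin radical has index `p`, it contains every kernel, and all non-thin relations have the same
kernel. If the quotient is cyclic, `ker` is monotone in the cyclic subgroup generated by the label
of a relation. Labels prime to `p` give the largest kernel, and the non-thin labels divisible by `p`
share one kernel. In the remaining case the kernel of every non-thin relation in `O_θ O^θ` is `O_θ ∩
O^θ`, while a relation outside has valency `p ^ 2`, so its neighbourhoods are full cosets of `O^θ`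
and absorption is automatic. -/

theorem exists_rel_mem (x y : X) : ∃ s : S.Rel, (x, y) ∈ s.1 := by
  obtain ⟨s, ⟨hs, hxy⟩, -⟩ := S.isPartition.2 (x, y)
  exact ⟨⟨s, hs⟩, hxy⟩

/-- The relation containing the pair `(x, y)`. -/
noncomputable def rel (x y : X) : S.Rel := (S.exists_rel_mem x y).choose

theorem mem_rel (x y : X) : (x, y) ∈ (S.rel x y).1 := (S.exists_rel_mem x y).choose_spec

theorem mem_iff_rel_eq {s : S.Rel} {x y : X} : (x, y) ∈ s.1 ↔ S.rel x y = s := by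
  constructor
  · intro h
    obtain ⟨t, -, ht⟩ := S.isPartition.2 (x, y)
    exact Subtype.ext ((ht _ ⟨(S.rel x y).2, S.mem_rel x y⟩).trans (ht _ ⟨s.2, h⟩).symm)
  · rintro rfl
    exact S.mem_rel x y

theorem exists_rel_eq_pair (s : S.Rel) : ∃ x y, S.rel x y = s := by
  obtain ⟨⟨x, y⟩, h⟩ := S.rel_nonempty s
  exact ⟨x, y, S.mem_iff_rel_eq.1 h⟩

theorem inter_rel (s t : S.Rel) (x y : X) :
    S.inter s t (S.rel x y) = Set.ncard {z : X | S.rel x z = s ∧ S.rel z y = t} := by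
  rw [S.inter_eq s t _ (S.mem_rel x y)]
  simp only [mem_iff_rel_eq]

theorem inter_rel_ne_zero {s t : S.Rel} {x y : X} :
    S.inter s t (S.rel x y) ≠ 0 ↔ ∃ z, S.rel x z = s ∧ S.rel z y = t := by
  rw [inter_rel, ← Nat.pos_iff_ne_zero, Set.ncard_pos (Set.toFinite _)]
  rfl

variable {S}

theorem exists_triangle {x y x' y' : X} (h : S.rel x y = S.rel x' y') (z : X) :
    ∃ z', S.rel x' z' = S.rel x z ∧ S.rel z' y' = S.rel z y := by
  rw [← inter_rel_ne_zero, ← h, inter_rel_ne_zero]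
  exact ⟨z, rfl, rfl⟩

theorem rel_swap (x y : X) : S.rel y x = S.star (S.rel x y) :=
  S.mem_iff_rel_eq.1 (S.mem_rel x y)

theorem rel_swap_eq {x y x' y' : X} (h : S.rel x y = S.rel x' y') : S.rel y x = S.rel y' x' := by
  rw [rel_swap, h, ← rel_swap]

theorem star_star (s : S.Rel) : S.star (S.star s) = s := rfl

theorem rel_eq_star {s : S.Rel} {x y : X} : S.rel x y = S.star s ↔ S.rel y x = s := by
  rw [rel_swap y x]
  exact ⟨fun h => by rw [← star_star (S.rel y x), h, star_star], fun h => by rw [h]⟩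

theorem rel_eq_one {x y : X} : S.rel x y = S.one ↔ x = y := by
  rw [← mem_iff_rel_eq]
  exact Set.mem_diagonal_iff

theorem rel_self (x : X) : S.rel x x = S.one := rel_eq_one.2 rfl

theorem exists_rel_eq (s : S.Rel) (x : X) : ∃ y, S.rel x y = s := by
  obtain ⟨a, b, rfl⟩ := S.exists_rel_eq_pair s
  obtain ⟨y, hy, -⟩ := exists_triangle ((rel_self a).trans (rel_self x).symm) b
  exact ⟨y, hy⟩

theorem exists_rel_eq_left (s : S.Rel) (y : X) : ∃ x, S.rel x y = s := by
  obtain ⟨x, hx⟩ := exists_rel_eq (S.star s) y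
  exact ⟨x, rel_eq_star.1 hx⟩

theorem IsCommutative.exists_swap (hc : S.IsCommutative) (x z y : X) :
    ∃ z', S.rel x z' = S.rel z y ∧ S.rel z' y = S.rel x z := by
  rw [← inter_rel_ne_zero, hc, inter_rel_ne_zero]
  exact ⟨z, rfl, rfl⟩

theorem valency_eq_ncard (s : S.Rel) (x : X) : S.valency s = Set.ncard {y | S.rel x y = s} := by
  rw [valency, ← rel_self x, inter_rel]
  simp only [rel_eq_star, and_self]

theorem order_eq_ncard (U : Set S.Rel) (x : X) : S.order U = Set.ncard {y | S.rel x y ∈ U} := by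
  classical
  have := Fintype.ofFinite X
  have := Fintype.ofFinite S.Rel
  rw [order, finsum_mem_eq_finite_toFinset_sum _ (Set.toFinite U), Set.ncard_eq_toFinset_card',
    Finset.card_eq_sum_card_fiberwise (f := S.rel x) (t := (Set.toFinite U).toFinset)]
  · refine Finset.sum_congr rfl fun s hs => ?_
    rw [valency_eq_ncard s x, Set.ncard_eq_toFinset_card']
    congr 1
    ext y
    simp only [Set.Finite.mem_toFinset] at hs
    simp only [Set.mem_toFinset, Set.mem_ofPred_eq, Finset.mem_filter]
    exact ⟨fun h => ⟨h ▸ hs, h⟩, fun h => h.2⟩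
  · intro y hy
    simpa using hy

theorem rel_mem_complexMul {P Q : Set S.Rel} {x y : X} :
    S.rel x y ∈ S.complexMul P Q ↔ ∃ z, S.rel x z ∈ P ∧ S.rel z y ∈ Q := by
  constructor
  · rintro ⟨p, hp, q, hq, h⟩
    obtain ⟨z, rfl, rfl⟩ := S.inter_rel_ne_zero.1 h
    exact ⟨z, hp, hq⟩
  · rintro ⟨z, hp, hq⟩
    exact ⟨_, hp, _, hq, S.inter_rel_ne_zero.2 ⟨z, rfl, rfl⟩⟩

theorem isClosedSubset_of_trans {T : Set S.Rel} (h1 : T.Nonempty)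
    (h : ∀ x y z, S.rel x y ∈ T → S.rel y z ∈ T → S.rel x z ∈ T) : S.IsClosedSubset T := by
  refine ⟨h1, fun s hs => ?_⟩
  obtain ⟨x, y, rfl⟩ := S.exists_rel_eq_pair s
  obtain ⟨z, hxz, hzy⟩ := rel_mem_complexMul.1 hs
  exact h _ _ _ hxz hzy

namespace IsClosedSubset

variable {T : Set S.Rel}

theorem rel_trans (hT : S.IsClosedSubset T) {x y z : X} (h : S.rel x y ∈ T)
    (h' : S.rel y z ∈ T) : S.rel x z ∈ T :=
  hT.2 (rel_mem_complexMul.2 ⟨y, h, h'⟩)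

/-- One inclusion is `TT ⊆ T`; equal finite cardinalities give the other. Hence the identity and
inverses come for free. -/
theorem setOf_rel_mem_eq (hT : S.IsClosedSubset T) {x y : X} (h : S.rel x y ∈ T) :
    {z | S.rel y z ∈ T} = {z | S.rel x z ∈ T} := by
  refine Set.eq_of_subset_of_ncard_le (fun z hz => hT.rel_trans h hz) ?_ (Set.toFinite _)
  rw [← order_eq_ncard, ← order_eq_ncard]

theorem one_mem (hT : S.IsClosedSubset T) : S.one ∈ T := by
  obtain ⟨t, ht⟩ := hT.1
  obtain ⟨x, y, rfl⟩ := S.exists_rel_eq_pair t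
  have : y ∈ {z | S.rel y z ∈ T} := by
    rw [hT.setOf_rel_mem_eq ht]
    exact ht
  rwa [← rel_self y]

theorem rel_self_mem (hT : S.IsClosedSubset T) (x : X) : S.rel x x ∈ T := by
  rw [rel_self]
  exact hT.one_mem

theorem rel_symm (hT : S.IsClosedSubset T) {x y : X} (h : S.rel x y ∈ T) : S.rel y x ∈ T := by
  have : x ∈ {z | S.rel y z ∈ T} := by
    rw [hT.setOf_rel_mem_eq h]
    exact hT.rel_self_mem x
  exact this

/-- The equivalence relation on points whose classes are the sets `xT`. -/
def setoid (hT : S.IsClosedSubset T) : Setoid X where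
  r x y := S.rel x y ∈ T
  iseqv := ⟨hT.rel_self_mem, hT.rel_symm, hT.rel_trans⟩

end IsClosedSubset

theorem mem_thinRadical_iff (s : S.Rel) (x : X) :
    s ∈ S.thinRadical ↔ ∀ y z, S.rel x y = s → S.rel x z = s → y = z := by
  rw [thinRadical, Set.mem_ofPred_eq, valency_eq_ncard s x]
  constructor
  · intro h y z hy hz
    obtain ⟨a, ha⟩ := Set.ncard_eq_one.1 h
    have h1 : y ∈ {y | S.rel x y = s} := hy
    have h2 : z ∈ {y | S.rel x y = s} := hz
    rw [ha] at h1 h2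
    exact h1.trans h2.symm
  · intro h
    obtain ⟨y, hy⟩ := exists_rel_eq s x
    exact Set.ncard_eq_one.2 ⟨y, Set.eq_singleton_iff_unique_mem.2 ⟨hy, fun z hz => h _ _ hz hy⟩⟩

theorem eq_of_rel_mem_thinRadical {x y z : X} (h : S.rel x y ∈ S.thinRadical)
    (hz : S.rel x z = S.rel x y) : z = y :=
  (mem_thinRadical_iff _ x).1 h _ _ hz rfl

theorem isClosedSubset_thinRadical : S.IsClosedSubset S.thinRadical := by
  refine isClosedSubset_of_trans ?_ fun x z y hxz hzy => ?_
  · obtain ⟨⟨x, y⟩, -⟩ := S.rel_nonempty S.one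
    refine ⟨S.one, (mem_thinRadical_iff _ x).2 fun y z hy hz => ?_⟩
    rw [← rel_eq_one.1 hy, ← rel_eq_one.1 hz]
  · suffices h : ∀ w, S.rel x w = S.rel x y → w = y from
      (mem_thinRadical_iff _ x).2 fun v w hv hw => (h v hv).trans (h w hw).symm
    intro w hw
    obtain ⟨z', h1, h2⟩ := exists_triangle hw.symm z
    rw [eq_of_rel_mem_thinRadical hxz h1] at h2
    exact eq_of_rel_mem_thinRadical hzy h2

theorem isClosedSubset_univ : S.IsClosedSubset Set.univ :=
  isClosedSubset_of_trans ⟨S.one, trivial⟩ fun _ _ _ _ _ => trivial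

/-! ### Absorption and extension of partial automorphisms. -/

/-- `v` absorbs `s` if `s^* s v = {v}`. -/
def Absorbs (s v : S.Rel) : Prop :=
  ∀ a x w y, S.rel a x = s → S.rel a w = s → S.rel w y = v → S.rel x y = v

theorem absorbs_of_mem_thinRadical {s : S.Rel} (hs : s ∈ S.thinRadical) (v : S.Rel) :
    Absorbs s v := by
  intro a x w y h1 h2 h3
  rwa [(mem_thinRadical_iff s a).1 hs _ _ h1 h2]

/-- Under absorption, the relations from a common point `a` to `x` and `y` determine the one from
`x` to `y`. -/
theorem Absorbs.rel_eq {a x y a' x' y' : X} (h : Absorbs (S.rel a x) (S.rel x y))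
    (hx : S.rel a' x' = S.rel a x) (hy : S.rel a' y' = S.rel a y) :
    S.rel x' y' = S.rel x y := by
  obtain ⟨w, h1, h2⟩ := exists_triangle hy.symm x
  exact h a' x' w y' hx h1 h2

/-- The anchor is chosen as close to `y` as possible: in thin relation to it, else in relation `U`,
else arbitrary. This choice ensures that only the assumed absorptions are needed. -/
theorem exists_extension {U : Set S.Rel} (hU : S.IsClosedSubset U)
    (hin : ∀ s ∈ U, ∀ v ∈ U, s ∉ S.thinRadical → v ∉ S.thinRadical → Absorbs s v)
    (hout : ∀ s, ∀ v ∉ U, Absorbs s v) (D : Set X) (hD : D.Nonempty) (g : X → X)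
    (hg : ∀ a ∈ D, ∀ b ∈ D, S.rel (g a) (g b) = S.rel a b) (y : X) :
    ∃ y', ∀ d ∈ D, S.rel (g d) y' = S.rel d y := by
  by_cases h1 : ∃ a ∈ D, S.rel a y ∈ S.thinRadical
  · obtain ⟨a, ha, hay⟩ := h1
    obtain ⟨y', hy'⟩ := exists_rel_eq (S.rel a y) (g a)
    refine ⟨y', fun d hd => rel_swap_eq ?_⟩
    exact (absorbs_of_mem_thinRadical hay _).rel_eq hy' (hg a ha d hd)
  push Not at h1
  by_cases h2 : ∃ a ∈ D, S.rel a y ∈ U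
  · obtain ⟨a, ha, hay⟩ := h2
    obtain ⟨y', hy'⟩ := exists_rel_eq (S.rel a y) (g a)
    refine ⟨y', fun d hd => Absorbs.rel_eq ?_ (hg a ha d hd) hy'⟩
    by_cases hdy : S.rel d y ∈ U
    · by_cases had : S.rel a d ∈ S.thinRadical
      · exact absorbs_of_mem_thinRadical had _
      · exact hin _ (hU.rel_trans hay (hU.rel_symm hdy)) _ hdy had (h1 d hd)
    · exact hout _ _ hdy
  push Not at h2
  obtain ⟨a, ha⟩ := hD
  obtain ⟨y', hy'⟩ := exists_rel_eq (S.rel a y) (g a)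
  exact ⟨y', fun d hd => (hout _ _ (h2 d hd)).rel_eq (hg a ha d hd) hy'⟩

theorem isSchurian_of_exists_perm
    (h : ∀ x y x' y', S.rel x y = S.rel x' y' →
      ∃ g : Equiv.Perm X, (∀ a b, S.rel (g a) (g b) = S.rel a b) ∧ g x = x' ∧ g y = y') :
    S.IsSchurian := by
  let G : Subgroup (Equiv.Perm X) :=
    { carrier := {g | ∀ a b, S.rel (g a) (g b) = S.rel a b}
      one_mem' := fun a b => rfl
      mul_mem' := fun {g k} hg hk a b => (hg (k a) (k b)).trans (hk a b)
      inv_mem' := fun {g} hg a b => by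
        simpa using (hg (g⁻¹ a) (g⁻¹ b)).symm }
  have horb : ∀ q : X × X, MulAction.orbit G q = (S.rel q.1 q.2).1 := by
    rintro ⟨x, y⟩
    ext ⟨x', y'⟩
    rw [mem_iff_rel_eq]
    constructor
    · rintro ⟨g, hg⟩
      obtain ⟨rfl, rfl⟩ := Prod.ext_iff.1 hg
      exact g.2 x y
    · intro hr
      obtain ⟨g, hg, rfl, rfl⟩ := h x y x' y' hr.symm
      exact ⟨⟨g, hg⟩, rfl⟩
  refine ⟨G, ⟨fun x y => ?_⟩, ?_⟩
  · obtain ⟨g, hg, hx, -⟩ := h x x y y ((rel_self x).trans (rel_self y).symm)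
    exact ⟨⟨g, hg⟩, hx⟩
  · ext s
    constructor
    · intro hs
      obtain ⟨x, y, hxy⟩ := S.exists_rel_eq_pair ⟨s, hs⟩
      exact ⟨(x, y), by simp only [horb, hxy]⟩
    · rintro ⟨q, rfl⟩
      simp only [horb]
      exact (S.rel q.1 q.2).2

/-- Under these absorption conditions every partial isomorphism extends to an automorphism. -/
theorem isSchurian_of_absorbs {U : Set S.Rel} (hU : S.IsClosedSubset U)
    (hin : ∀ s ∈ U, ∀ v ∈ U, s ∉ S.thinRadical → v ∉ S.thinRadical → Absorbs s v)
    (hout : ∀ s, ∀ v ∉ U, Absorbs s v) : S.IsSchurian := by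
  classical
  refine isSchurian_of_exists_perm fun x y x' y' hxy => ?_
  have hstep : ∀ D : Finset X, ∃ g : X → X, g x = x' ∧ g y = y' ∧
      ∀ a ∈ insert x (insert y (D : Set X)), ∀ b ∈ insert x (insert y (D : Set X)),
        S.rel (g a) (g b) = S.rel a b := by
    intro D
    induction D using Finset.induction_on with
    | empty =>
      -- If `y = x` then `rel x' y'` is the diagonal, so `x' = y'` and the map is still right.
      refine ⟨fun z => if z = x then x' else y', by simp, ?_, ?_⟩
      · by_cases h : y = x
        · subst h
          rw [rel_self] at hxy
          simpa using rel_eq_one.1 hxy.symm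
        · simp [h]
      · have hyx := rel_swap_eq hxy
        by_cases h : y = x
        · subst h
          simp [rel_self]
        · simp [h, rel_self, hxy, hyx]
    | insert z D _ ih =>
      obtain ⟨g, hx, hy, hg⟩ := ih
      by_cases hz : z ∈ insert x (insert y (D : Set X))
      · refine ⟨g, hx, hy, ?_⟩
        have : insert x (insert y ((insert z D : Finset X) : Set X))
            = insert x (insert y (D : Set X)) := by
          rw [Finset.coe_insert, Set.insert_comm y z, Set.insert_comm x z, Set.insert_eq_of_mem hz]
        rwa [this]
      · obtain ⟨z', hz'⟩ := exists_extension hU hin hout _ ⟨x, Set.mem_insert _ _⟩ g hg z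
        have hne : ∀ d ∈ insert x (insert y (D : Set X)), Function.update g z z' d = g d :=
          fun d hd => Function.update_of_ne (by rintro rfl; exact hz hd) _ _
        refine ⟨Function.update g z z', ?_, ?_, ?_⟩
        · rw [hne x (by simp), hx]
        · rw [hne y (by simp), hy]
        · rw [Finset.coe_insert, Set.insert_comm y z, Set.insert_comm x z]
          rintro a (rfl | ha) b (rfl | hb)
          · simp [rel_self]
          · rw [hne b hb, Function.update_self]
            exact rel_swap_eq (hz' b hb)
          · rw [hne a ha, Function.update_self]
            exact hz' a ha
          · rw [hne a ha, hne b hb]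
            exact hg a ha b hb
  have := Fintype.ofFinite X
  obtain ⟨g, hx, hy, hg⟩ := hstep Finset.univ
  replace hg : ∀ a b, S.rel (g a) (g b) = S.rel a b := fun a b =>
    hg a (by simp) b (by simp)
  have hinj : Function.Injective g := fun a b hab =>
    rel_eq_one.1 (by rw [← hg a b, hab, rel_self])
  exact ⟨Equiv.ofBijective g (Finite.injective_iff_bijective.1 hinj), hg, hx, hy⟩

end Points

end AssocScheme

namespace AssocScheme

/-! ### Counting points in cosets. -/

section Counting

variable {X : Type*} [Finite X] {S : AssocScheme X}

theorem ncard_eq_ncard_image_mul {Y : Type*} (r : X → Y) (A : Set X) (k : ℕ)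
    (h : ∀ y ∈ A, Set.ncard {z | z ∈ A ∧ r z = r y} = k) :
    A.ncard = (r '' A).ncard * k := by
  classical
  have := Fintype.ofFinite X
  rw [Set.ncard_eq_toFinset_card', Set.ncard_eq_toFinset_card', Set.toFinset_image,
    Finset.card_eq_sum_card_image r, Finset.sum_const_nat]
  intro c hc
  obtain ⟨y, hy, rfl⟩ := Finset.mem_image.1 hc
  rw [← h y (by simpa using hy), Set.ncard_eq_toFinset_card']
  congr 1
  ext z
  simp

theorem order_dvd_order {T R : Set S.Rel} (hT : S.IsClosedSubset T) (hR : S.IsClosedSubset R)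
    (hTR : T ⊆ R) : S.order T ∣ S.order R := by
  obtain ⟨x, -⟩ := S.exists_rel_eq_pair S.one
  rw [order_eq_ncard R x, ncard_eq_ncard_image_mul (Quotient.mk hT.setoid) _ (S.order T)]
  · exact Dvd.intro_left _ rfl
  · intro y hy
    rw [order_eq_ncard T y]
    congr 1
    ext z
    simp only [Set.mem_ofPred_eq, Quotient.eq]
    exact ⟨fun h => hT.rel_symm h.2, fun h => ⟨hR.rel_trans hy (hTR h), hT.rel_symm h⟩⟩

theorem eq_of_subset_of_order_le {T R : Set S.Rel} (hTR : T ⊆ R) (h : S.order R ≤ S.order T) :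
    T = R := by
  obtain ⟨x, -⟩ := S.exists_rel_eq_pair S.one
  rw [order_eq_ncard T x, order_eq_ncard R x] at h
  refine hTR.antisymm fun s hs => ?_
  obtain ⟨y, rfl⟩ := exists_rel_eq s x
  have hsub : {y | S.rel x y ∈ T} ⊆ {y | S.rel x y ∈ R} := fun y hy => hTR hy
  have : y ∈ {y | S.rel x y ∈ T} := by
    rw [Set.eq_of_subset_of_ncard_le hsub h (Set.toFinite _)]
    exact hs
  exact this

/-- The set `xs` meets `m` cosets of `T`, all in equally many points, so `m` divides `p ^ k`. These
cosets and `xT` are disjoint inside `xR`, which has `p` cosets, so `m < p` and `m = 1`. -/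
theorem rel_mem_of_order_eq_mul {p k : ℕ} (hp : p.Prime) {T R : Set S.Rel}
    (hT : S.IsClosedSubset T) (hR : S.IsClosedSubset R) (hTR : T ⊆ R)
    (hord : S.order R = p * S.order T) {s : S.Rel} (hs : s ∈ R) (hsT : s ∉ T)
    (hk : S.valency s = p ^ k) {x y z : X} (hy : S.rel x y = s) (hz : S.rel x z = s) :
    S.rel y z ∈ T := by
  let q : X → Quotient hT.setoid := Quotient.mk hT.setoid
  have hq : ∀ a b, q a = q b ↔ S.rel a b ∈ T := fun a b => Quotient.eq
  let A : Set X := {y | S.rel x y = s}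
  let B : Set X := {z | ∃ y ∈ A, q z = q y}
  have hT0 : 0 < S.order T := by
    rw [order_eq_ncard T x, Set.ncard_pos (Set.toFinite _)]
    exact ⟨x, hT.rel_self_mem x⟩
  have hA : A.ncard = (q '' A).ncard * Set.ncard {w | w ∈ A ∧ q w = q y} := by
    refine ncard_eq_ncard_image_mul q A _ fun y' hy' => ?_
    have hyy : S.rel x y' = S.rel x y := Eq.trans hy' hy.symm
    -- The part of `xs` in the coset of `b` is counted by intersection numbers, hence does not
    -- depend on `b`.
    have key : ∀ b, S.rel x b = s → Set.ncard {w | w ∈ A ∧ q w = q b} =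
        ∑ᶠ t ∈ T, S.inter s t s := by
      classical
      intro b hb
      have := Fintype.ofFinite X
      have := Fintype.ofFinite S.Rel
      rw [finsum_mem_eq_finite_toFinset_sum _ (Set.toFinite T), Set.ncard_eq_toFinset_card',
        Finset.card_eq_sum_card_fiberwise (f := fun w => S.rel w b)
          (t := (Set.toFinite T).toFinset)]
      · refine Finset.sum_congr rfl fun t ht => ?_
        rw [Set.Finite.mem_toFinset] at ht
        conv_rhs => rw [← hb, inter_rel, Set.ncard_eq_toFinset_card', hb]
        congr 1
        ext w
        simp only [Finset.mem_filter, Set.mem_toFinset, Set.mem_ofPred_eq, hq]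
        exact ⟨fun h => ⟨h.1.1, h.2⟩, fun h => ⟨⟨h.1, h.2 ▸ ht⟩, h.2⟩⟩
      · intro w hw
        simp only [Set.coe_toFinset, Set.mem_ofPred_eq, hq] at hw
        simpa using hw.2
    rw [key y' hy', key y hy]
  have hB : B.ncard = (q '' A).ncard * S.order T := by
    rw [ncard_eq_ncard_image_mul q B (S.order T)]
    · congr 2
      ext c
      constructor
      · rintro ⟨b, ⟨a, ha, hab⟩, rfl⟩
        exact ⟨a, ha, hab.symm⟩
      · rintro ⟨a, ha, rfl⟩
        exact ⟨a, ⟨a, ha, rfl⟩, rfl⟩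
    · rintro b ⟨a, ha, hab⟩
      rw [order_eq_ncard T b]
      congr 1
      ext w
      simp only [Set.mem_ofPred_eq]
      rw [hq]
      refine ⟨fun h => hT.rel_symm h.2, fun h => ⟨⟨a, ha, ?_⟩, hT.rel_symm h⟩⟩
      rw [← hab, hq]
      exact hT.rel_symm h
  have hBT : B.ncard + S.order T ≤ S.order R := by
    rw [order_eq_ncard T x, order_eq_ncard R x, ← Set.ncard_union_eq _ (Set.toFinite _)
      (Set.toFinite _)]
    · refine Set.ncard_le_ncard ?_ (Set.toFinite _)
      rintro b (⟨a, ha, hab⟩ | hb)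
      · rw [hq] at hab
        refine hR.rel_trans ?_ (hTR (hT.rel_symm hab))
        rw [show S.rel x a = s from ha]
        exact hs
      · exact hTR hb
    · rw [Set.disjoint_left]
      rintro b ⟨a, ha, hab⟩ hb
      rw [hq] at hab
      refine hsT ?_
      rw [← show S.rel x a = s from ha]
      exact hT.rel_trans hb hab
  have hm1 : (q '' A).ncard = 1 := by
    have hdvd : (q '' A).ncard ∣ p ^ k := by
      rw [← hk, valency_eq_ncard s x]
      exact Dvd.intro _ hA.symm
    obtain ⟨j, -, hj⟩ := (Nat.dvd_prime_pow hp).1 hdvd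
    rw [hB, hord] at hBT
    have hlt : (q '' A).ncard < p := by
      by_contra hcon
      push Not at hcon
      have := Nat.mul_le_mul_right (S.order T) hcon
      omega
    rcases j with _ | j
    · simpa using hj
    · rw [hj, pow_succ] at hlt
      have := Nat.mul_le_mul_right p (Nat.one_le_pow j p hp.pos)
      omega
  obtain ⟨c, hc⟩ := Set.ncard_eq_one.1 hm1
  have h1 : q y ∈ q '' A := ⟨y, hy, rfl⟩
  have h2 : q z ∈ q '' A := ⟨z, hz, rfl⟩
  rw [hc] at h1 h2
  exact (hq y z).1 (h1.trans h2.symm)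

end Counting

/-! ### The products `s^* s` in a commutative scheme. -/

section Kernel

variable {X : Type*} [Finite X] {S : AssocScheme X}

/-- The complex product `s^* s`. -/
def ker (s : S.Rel) : Set S.Rel := S.complexMul {S.star s} {s}

theorem rel_mem_ker {s : S.Rel} {x w : X} :
    S.rel x w ∈ ker s ↔ ∃ a, S.rel a x = s ∧ S.rel a w = s := by
  simp only [ker, rel_mem_complexMul, Set.mem_singleton_iff, rel_eq_star]

theorem IsCommutative.rel_mem_ker_iff (hc : S.IsCommutative) {s : S.Rel} {x w : X} :
    S.rel x w ∈ ker s ↔ ∃ a, S.rel x a = s ∧ S.rel w a = s := by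
  rw [rel_mem_ker]
  constructor
  · rintro ⟨a, h1, h2⟩
    obtain ⟨b, h3, h4⟩ := hc.exists_swap x a w
    exact ⟨b, h3.trans h2, (rel_swap_eq h4).trans h1⟩
  · rintro ⟨a, h1, h2⟩
    obtain ⟨b, h3, h4⟩ := hc.exists_swap x a w
    exact ⟨b, (rel_swap_eq h3).trans h2, h4.trans h1⟩

theorem ker_subset_iff {s : S.Rel} {H : Set S.Rel} :
    ker s ⊆ H ↔ ∀ a x w, S.rel a x = s → S.rel a w = s → S.rel x w ∈ H := by
  constructor
  · exact fun h a x w hx hw => h (rel_mem_ker.2 ⟨a, hx, hw⟩)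
  · intro h t ht
    obtain ⟨x, w, rfl⟩ := S.exists_rel_eq_pair t
    obtain ⟨a, hx, hw⟩ := rel_mem_ker.1 ht
    exact h a x w hx hw

theorem IsStronglyNormal.ker_subset {T : Set S.Rel} (hT : S.IsStronglyNormal T) (s : S.Rel) :
    ker s ⊆ T := by
  rw [ker_subset_iff]
  intro a x w hx hw
  exact hT.2 s (rel_mem_complexMul.2 ⟨a, rel_mem_complexMul.2 ⟨a, rel_eq_star.2 hx,
    hT.1.rel_self_mem a⟩, hw⟩)

theorem isStronglyNormal_thinResidue : S.IsStronglyNormal S.thinResidue := by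
  refine ⟨isClosedSubset_of_trans ⟨S.one, fun T hT => hT.1.one_mem⟩ fun x y z h h' T hT =>
    hT.1.rel_trans (h T hT) (h' T hT), fun s t ht T hT => hT.2 s ?_⟩
  obtain ⟨x, y, rfl⟩ := S.exists_rel_eq_pair t
  obtain ⟨z, hz, hzy⟩ := rel_mem_complexMul.1 ht
  obtain ⟨w, hw, hwz⟩ := rel_mem_complexMul.1 hz
  exact rel_mem_complexMul.2 ⟨z, rel_mem_complexMul.2 ⟨w, hw, hwz T hT⟩, hzy⟩

theorem ker_of_mem_thinRadical {s : S.Rel} (hs : s ∈ S.thinRadical) : ker s ⊆ {S.one} := by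
  rw [ker_subset_iff]
  intro a x w hx hw
  exact rel_eq_one.2 ((mem_thinRadical_iff s a).1 hs _ _ hx hw)

/-- Since `v^* v = v v^*`, some `b` is a common `v`-neighbour of `x` and `w`; as `rel x w` is thin,
all `v`-neighbours of `w` have the same relation to `x` as `b`. -/
theorem IsCommutative.rel_eq_of_rel_mem_ker (hc : S.IsCommutative) {v : S.Rel} {x w y : X}
    (h : S.rel x w ∈ ker v) (hthin : S.rel x w ∈ S.thinRadical) (hv : S.rel w y = v) :
    S.rel x y = v := by
  obtain ⟨b, h1, h2⟩ := hc.rel_mem_ker_iff.1 h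
  have := (absorbs_of_mem_thinRadical (isClosedSubset_thinRadical.rel_symm hthin)
    (S.rel x b)).rel_eq rfl (hv.trans h2.symm)
  exact this.trans h1

theorem IsCommutative.absorbs (hc : S.IsCommutative) {s v : S.Rel}
    (hs : ker s ⊆ S.thinRadical) (hsv : ker s ⊆ ker v) : Absorbs s v := by
  intro a x w y hx hw hv
  have h := rel_mem_ker.2 ⟨a, hx, hw⟩
  exact hc.rel_eq_of_rel_mem_ker (hsv h) (hs h) hv

theorem IsCommutative.isClosedSubset_ker (hc : S.IsCommutative) {v : S.Rel}
    (hv : ker v ⊆ S.thinRadical) : S.IsClosedSubset (ker v) := by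
  refine isClosedSubset_of_trans ?_ fun x y z hxy hyz => ?_
  · obtain ⟨x, y, h⟩ := S.exists_rel_eq_pair v
    exact ⟨S.rel y y, rel_mem_ker.2 ⟨x, h, h⟩⟩
  · obtain ⟨b, h1, h2⟩ := hc.rel_mem_ker_iff.1 hyz
    exact hc.rel_mem_ker_iff.2 ⟨b, hc.rel_eq_of_rel_mem_ker hxy (hv hxy) h1, h2⟩

/-- By commutativity, `(uv)^* (uv) ⊆ (u^* u)(v^* v)`. -/
theorem IsCommutative.isClosedSubset_setOf_ker_subset (hc : S.IsCommutative) {H : Set S.Rel}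
    (hH : S.IsClosedSubset H) : S.IsClosedSubset {u | ker u ⊆ H} := by
  refine isClosedSubset_of_trans ⟨S.one, ?_⟩ fun x₀ y₀ z₀ h₁ h₂ => ?_
  · refine (ker_of_mem_thinRadical isClosedSubset_thinRadical.one_mem).trans ?_
    exact Set.singleton_subset_iff.2 hH.one_mem
  · refine ker_subset_iff.2 fun x z w hz hw => ?_
    obtain ⟨y, hy, hyz⟩ := exists_triangle hz.symm y₀
    obtain ⟨y', hy', hyw⟩ := exists_triangle hw.symm y₀
    have hyy : S.rel y y' ∈ H := h₁ (rel_mem_ker.2 ⟨x, hy, hy'⟩)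
    obtain ⟨q, hq, hqy⟩ := hc.exists_swap z y y'
    have hqw : S.rel q w ∈ H :=
      h₂ (rel_mem_ker.2 ⟨y', (rel_swap_eq hqy).trans hyz, hyw⟩)
    exact hH.rel_trans (hq ▸ hyy) hqw

theorem IsCommutative.isClosedSubset_complexMul (hc : S.IsCommutative) {T R : Set S.Rel}
    (hT : S.IsClosedSubset T) (hR : S.IsClosedSubset R) :
    S.IsClosedSubset (S.complexMul T R) := by
  refine isClosedSubset_of_trans ⟨S.one, ?_⟩ fun x y z hxy hyz => ?_
  · obtain ⟨x, -⟩ := S.exists_rel_eq_pair S.one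
    rw [← rel_self x, rel_mem_complexMul]
    exact ⟨x, hT.rel_self_mem x, hR.rel_self_mem x⟩
  · obtain ⟨a, ha, hay⟩ := rel_mem_complexMul.1 hxy
    obtain ⟨b, hb, hbz⟩ := rel_mem_complexMul.1 hyz
    obtain ⟨c, hc1, hc2⟩ := hc.exists_swap a y b
    exact rel_mem_complexMul.2 ⟨c, hT.rel_trans ha (hc1 ▸ hb), hR.rel_trans (hc2 ▸ hay) hbz⟩

end Kernel

/-! ### Thin radical of index `p`. -/

section Cases

variable {X : Type*} [Finite X] {S : AssocScheme X}

theorem IsCommutative.isSchurian_of_order_thinRadical (hc : S.IsCommutative) {p k : ℕ}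
    (hp : p.Prime) (hpS : S.IsPScheme p) (hord : S.order Set.univ = p ^ (k + 1))
    (h : S.order S.thinRadical = p ^ k) : S.IsSchurian := by
  have hT : S.IsClosedSubset S.thinRadical := isClosedSubset_thinRadical
  have hker : ∀ s, ker s ⊆ S.thinRadical := by
    intro s
    by_cases hs : s ∈ S.thinRadical
    · exact (ker_of_mem_thinRadical hs).trans (Set.singleton_subset_iff.2 hT.one_mem)
    · obtain ⟨j, hj⟩ := hpS.1 s
      refine ker_subset_iff.2 fun a x w hx hw => rel_mem_of_order_eq_mul hp hT isClosedSubset_univ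
        (Set.subset_univ _) ?_ trivial hs hj hx hw
      rw [hord, h, pow_succ']
  refine isSchurian_of_absorbs isClosedSubset_univ (fun s _ v _ _ hv => ?_)
    fun _ v hv => absurd trivial hv
  refine hc.absorbs (hker s) ?_
  -- The relations with kernel in `ker v` form a closed set containing the thin radical and the
  -- non-thin `v`, so index `p` forces it to be everything.
  have hW := hc.isClosedSubset_setOf_ker_subset (hc.isClosedSubset_ker (hker v))
  have hTW : S.thinRadical ⊆ {u | ker u ⊆ ker v} := fun t ht =>
    (ker_of_mem_thinRadical ht).trans
      (Set.singleton_subset_iff.2 (hc.isClosedSubset_ker (hker v)).one_mem)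
  have hdvd := order_dvd_order hW isClosedSubset_univ (Set.subset_univ _)
  rw [hord] at hdvd
  obtain ⟨j, hj, hjW⟩ := (Nat.dvd_prime_pow hp).1 hdvd
  have hjk : ¬ j ≤ k := by
    intro hle
    have := eq_of_subset_of_order_le hTW (by rw [hjW, h]; exact Nat.pow_le_pow_right hp.pos hle)
    rw [this] at hv
    exact hv (fun _ h => h)
  have hWuniv := eq_of_subset_of_order_le (Set.subset_univ {u | ker u ⊆ ker v})
    (by rw [hjW, hord]; exact Nat.pow_le_pow_right hp.pos (by omega))
  have : s ∈ {u | ker u ⊆ ker v} := by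
    rw [hWuniv]
    trivial
  exact this

end Cases

end AssocScheme

namespace AssocScheme

/-! ### Distinct thin radical and residue; cyclic quotient. -/

section Cases

variable {X : Type*} [Finite X] {S : AssocScheme X}

/-- The set `zv` lies in `yH` and is at least as large, so the two agree. -/
theorem rel_eq_of_order_le_valency {H : Set S.Rel} {v : S.Rel} (hv : ker v ⊆ H)
    (hle : S.order H ≤ S.valency v) {z y w : X} (hy : S.rel z y = v) (hw : S.rel y w ∈ H) :
    S.rel z w = v := by
  rw [order_eq_ncard H y, valency_eq_ncard v z] at hle
  have hsub : {w | S.rel z w = v} ⊆ {w | S.rel y w ∈ H} := fun w hw =>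
    ker_subset_iff.1 hv z y w hy hw
  have : w ∈ {w | S.rel z w = v} := by
    rw [Set.eq_of_subset_of_ncard_le hsub hle (Set.toFinite _)]
    exact hw
  exact this

/-- Every non-thin valency is a multiple of `p`. -/
theorem dvd_order_thinRadical_inter {p : ℕ} (hpS : S.IsPScheme p)
    (R : Set S.Rel) : p ∣ S.order R → p ∣ S.order (S.thinRadical ∩ R) := by
  classical
  obtain ⟨x, -⟩ := S.exists_rel_eq_pair S.one
  have hsum : S.order R = S.order (S.thinRadical ∩ R) + S.order (R \ S.thinRadical) := by
    rw [Set.inter_comm]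
    simp only [order_eq_ncard _ x]
    exact (Set.ncard_inter_add_ncard_sdiff_eq_ncard {y | S.rel x y ∈ R}
      {y | S.rel x y ∈ S.thinRadical} (Set.toFinite _)).symm
  have hdvd : p ∣ S.order (R \ S.thinRadical) := by
    rw [order, finsum_mem_eq_finite_toFinset_sum _ (Set.toFinite _)]
    refine Finset.dvd_sum fun s hs => ?_
    rw [Set.Finite.mem_toFinset] at hs
    obtain ⟨_ | k, hk⟩ := hpS.1 s
    · exact absurd (hk.trans (pow_zero p)) hs.2
    · rw [hk, pow_succ]
      exact Dvd.intro_left _ rfl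
  intro h
  rw [hsum] at h
  exact (Nat.dvd_add_left hdvd).1 h

theorem IsCommutative.isSchurian_of_thinResidue_ne_thinRadical (hc : S.IsCommutative) {p : ℕ}
    (hp : p.Prime) (hpS : S.IsPScheme p) (hT2 : S.order S.thinRadical = p ^ 2)
    (hR2 : S.order S.thinResidue = p ^ 2) (hne : S.thinResidue ≠ S.thinRadical)
    (hval : ∀ s : S.Rel, s ∉ S.complexMul S.thinRadical S.thinResidue → S.valency s = p ^ 2) :
    S.IsSchurian := by
  have hT : S.IsClosedSubset S.thinRadical := isClosedSubset_thinRadical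
  have hRn : S.IsStronglyNormal S.thinResidue := isStronglyNormal_thinResidue
  have hR := hRn.1
  set T := S.thinRadical with hTdef
  set R := S.thinResidue
  have hZ : S.IsClosedSubset (T ∩ R) := isClosedSubset_of_trans ⟨S.one, hT.one_mem, hR.one_mem⟩
    fun x y z h h' => ⟨hT.rel_trans h.1 h'.1, hR.rel_trans h.2 h'.2⟩
  have hZp : S.order (T ∩ R) = p := by
    have hdvd := order_dvd_order hZ hR Set.inter_subset_right
    rw [hR2] at hdvd
    obtain ⟨j, hj, hjZ⟩ := (Nat.dvd_prime_pow hp).1 hdvd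
    have hpZ := dvd_order_thinRadical_inter hpS R (hR2 ▸ dvd_pow_self p two_ne_zero)
    rw [← hTdef, hjZ] at hpZ
    interval_cases j
    · exact absurd hpZ (by simpa using hp.one_lt.ne')
    · rw [hjZ, pow_one]
    · have h1 := eq_of_subset_of_order_le (Set.inter_subset_right : T ∩ R ⊆ R)
        (by rw [hjZ, hR2])
      have h2 := eq_of_subset_of_order_le (Set.inter_subset_left : T ∩ R ⊆ T)
        (by rw [hjZ, hT2])
      exact absurd (h1.symm.trans h2) hne
  have hkerR : ∀ r ∈ R, ker r ⊆ T ∩ R := by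
    intro r hr
    by_cases hrT : r ∈ T
    · exact (ker_of_mem_thinRadical hrT).trans (Set.singleton_subset_iff.2 hZ.one_mem)
    · obtain ⟨j, hj⟩ := hpS.1 r
      refine ker_subset_iff.2 fun a x w hx hw => rel_mem_of_order_eq_mul hp hZ hR
        Set.inter_subset_right ?_ hr (fun h => hrT h.1) hj hx hw
      rw [hR2, hZp, pow_two]
  have hfullR : ∀ z y w, S.rel z y ∈ R → S.rel z y ∉ T → S.rel y w ∈ T ∩ R →
      S.rel z w = S.rel z y := by
    intro z y w hzy hzyT hyw
    refine rel_eq_of_order_le_valency (hkerR _ hzy) ?_ rfl hyw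
    obtain ⟨_ | k, hk⟩ := hpS.1 (S.rel z y)
    · exact absurd (hk.trans (pow_zero p)) hzyT
    · rw [hZp, hk]
      exact Nat.le_self_pow k.succ_ne_zero p
  have hkerU : ∀ s ∈ S.complexMul T R, ker s ⊆ T ∩ R := by
    intro s hs
    obtain ⟨x, y, rfl⟩ := S.exists_rel_eq_pair s
    obtain ⟨z, hxz, hzy⟩ := rel_mem_complexMul.1 hs
    refine (hc.isClosedSubset_setOf_ker_subset hZ).rel_trans (y := z) ?_ (hkerR _ hzy)
    exact (ker_of_mem_thinRadical hxz).trans (Set.singleton_subset_iff.2 hZ.one_mem)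
  refine isSchurian_of_absorbs (hc.isClosedSubset_complexMul hT hR)
    (fun s hs v hv _ hvT => ?_) fun s v hv => ?_
  · refine hc.absorbs ((hkerU s hs).trans Set.inter_subset_left) ((hkerU s hs).trans ?_)
    -- Here `v` is in the product of a thin relation and some `r ∈ R \ T`; the thin factor carries
    -- `r t = r` over to `v t = v`.
    intro t ht
    obtain ⟨x, y, rfl⟩ := S.exists_rel_eq_pair v
    obtain ⟨w, rfl⟩ := exists_rel_eq t y
    obtain ⟨z, hxz, hzy⟩ := rel_mem_complexMul.1 hv
    have hzw := hfullR z y w hzy (fun h => hvT (hT.rel_trans hxz h)) ht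
    exact rel_mem_ker.2 ⟨x, rfl, (absorbs_of_mem_thinRadical (hT.rel_symm hxz) _).rel_eq rfl hzw⟩
  · intro a x w y hx hw hv'
    -- Swapping puts `v` first, so the remaining step from `q` to `y` lies in `ker s ⊆ R` and stays
    -- in a full coset.
    obtain ⟨q, hq, hqy⟩ := hc.exists_swap x w y
    refine rel_eq_of_order_le_valency (hRn.ker_subset v) ?_ (hq.trans hv') (hqy ▸ ?_)
    · rw [hR2, hval v hv]
    · exact hRn.ker_subset s (rel_mem_ker.2 ⟨a, hx, hw⟩)

theorem exists_labelling_of_isomorphic {T : Set S.Rel} (hT : S.IsClosedSubset T) {n : ℕ}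
    (h : Isomorphic (S.quotientRels T) (cyclicRels n)) :
    ∃ F : X → ZMod n, (∀ x y, F x = F y ↔ S.rel x y ∈ T) ∧
      ∀ x y x' y', S.rel x y = S.rel x' y' → F y - F x = F y' - F x' := by
  obtain ⟨φ, ψ, hψ⟩ := h
  refine ⟨fun x => φ (S.toPointQuotient T x), fun x y => ?_, fun x y x' y' hxy => ?_⟩
  · have hnbhd : ∀ x, S.nbhd x T = {z | S.rel x z ∈ T} := by
      intro x
      ext z
      constructor
      · rintro ⟨u, hu, hxz⟩
        rw [mem_iff_rel_eq] at hxz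
        subst hxz
        exact hu
      · exact fun hz => ⟨_, hz, S.mem_rel x z⟩
    rw [φ.apply_eq_iff_eq, Subtype.ext_iff]
    change S.nbhd x T = S.nbhd y T ↔ _
    rw [hnbhd, hnbhd]
    constructor
    · intro hxy
      have : y ∈ {z | S.rel y z ∈ T} := hT.rel_self_mem y
      rwa [← hxy] at this
    · exact fun hxy => (hT.setOf_rel_mem_eq hxy).symm
  · have key : ∀ a b, S.rel a b = S.rel x y →
        (S.toPointQuotient T a, S.toPointQuotient T b) ∈ S.quotientRel T (S.rel x y) := by
      intro a b hab
      refine ⟨a, b, ⟨S.rel a b, ?_, S.mem_rel a b⟩, rfl⟩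
      exact rel_mem_complexMul.2 ⟨b, rel_mem_complexMul.2 ⟨a, hT.rel_self_mem a, hab⟩,
        hT.rel_self_mem b⟩
    let c : S.quotientRels T := ⟨S.quotientRel T (S.rel x y), S.rel x y, rfl⟩
    have h1 := hψ c _ _ (key x y rfl)
    have h2 := hψ c _ _ (key x' y' hxy.symm)
    obtain ⟨g, hg⟩ := (ψ c).2
    rw [← hg] at h1 h2
    simp only [Set.mem_ofPred_eq] at h1 h2
    simp only [← h1, ← h2, add_sub_cancel_left]

theorem isUnit_of_not_prime_dvd {p : ℕ} (hp : p.Prime) (k : ℕ) {a : ZMod (p ^ k)}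
    (ha : ¬ (p : ZMod (p ^ k)) ∣ a) : IsUnit a := by
  have : NeZero (p ^ k) := ⟨pow_ne_zero k hp.ne_zero⟩
  rw [← ZMod.natCast_zmod_val a] at ha ⊢
  rw [ZMod.isUnit_iff_coprime]
  refine Nat.Coprime.pow_right k ((Nat.Prime.coprime_iff_not_dvd hp).2 fun h => ha ?_).symm
  exact_mod_cast Nat.cast_dvd_cast h

theorem IsCommutative.isSchurian_of_isomorphic_cyclicRels (hc : S.IsCommutative) {p : ℕ}
    (hp : p.Prime) (hTR : S.thinResidue = S.thinRadical)
    (h : Isomorphic (S.quotientRels S.thinResidue) (cyclicRels (p ^ 2))) : S.IsSchurian := by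
  have : NeZero (p ^ 2) := ⟨pow_ne_zero 2 hp.ne_zero⟩
  have hRn : S.IsStronglyNormal S.thinResidue := isStronglyNormal_thinResidue
  rw [hTR] at h hRn
  obtain ⟨F, hF, hFc⟩ := exists_labelling_of_isomorphic hRn.1 h
  have hker := hRn.ker_subset
  -- Peeling off a last step in relation `rel a b` lowers the multiple `k` by one.
  have hsub : ∀ (k : ℕ) (x y a b : X), F y - F x = k * (F b - F a) →
      ker (S.rel x y) ⊆ ker (S.rel a b) := by
    intro k x y a b
    have hH := hc.isClosedSubset_ker (hker (S.rel a b))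
    induction k generalizing y with
    | zero =>
      intro hk
      rw [Nat.cast_zero, zero_mul, sub_eq_zero, eq_comm, hF] at hk
      exact (ker_of_mem_thinRadical hk).trans (Set.singleton_subset_iff.2 hH.one_mem)
    | succ k ih =>
      intro hk
      obtain ⟨z, hz⟩ := exists_rel_eq_left (S.rel a b) y
      have hzy := hFc _ _ _ _ hz
      have h1 := ih z (by rw [← hzy]; rw [← hzy] at hk; push_cast at hk; linear_combination hk)
      have h2 : ker (S.rel z y) ⊆ ker (S.rel a b) := by rw [hz]
      exact (hc.isClosedSubset_setOf_ker_subset hH).rel_trans h1 h2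
  have hsub' : ∀ (c : ZMod (p ^ 2)) (x y a b : X), F y - F x = c * (F b - F a) →
      ker (S.rel x y) ⊆ ker (S.rel a b) := fun c x y a b hcc =>
    hsub c.val x y a b (by rw [ZMod.natCast_zmod_val, hcc])
  let U : Set S.Rel := {s | ∀ x y, S.rel x y = s → (p : ZMod (p ^ 2)) ∣ F y - F x}
  have hU : ∀ x y, S.rel x y ∈ U ↔ (p : ZMod (p ^ 2)) ∣ F y - F x := fun x y =>
    ⟨fun h => h x y rfl, fun h x' y' hxy => by rwa [hFc _ _ _ _ hxy]⟩
  have hUc : S.IsClosedSubset U := by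
    refine isClosedSubset_of_trans ⟨S.one, fun x y hxy => ?_⟩ fun x y z hxy hyz => ?_
    · rw [rel_eq_one.1 hxy, sub_self]
      exact dvd_zero _
    · rw [hU] at *
      rw [← sub_add_sub_cancel' (F y)]
      exact dvd_add hxy hyz
  refine isSchurian_of_absorbs hUc (fun s hs v hv _ hvT => ?_) fun s v hv => ?_
  · obtain ⟨x, y, rfl⟩ := S.exists_rel_eq_pair s
    obtain ⟨a, b, rfl⟩ := S.exists_rel_eq_pair v
    refine hc.absorbs (hker _) ?_
    obtain ⟨d, hd⟩ := (hU x y).1 hs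
    obtain ⟨e, he⟩ := (hU a b).1 hv
    have heu : IsUnit e := by
      -- If `p` divided `e`, the label of `v` would be a multiple of `p ^ 2 = 0`, making `v` thin.
      refine isUnit_of_not_prime_dvd hp 2 fun hpe => hvT ?_
      obtain ⟨f, rfl⟩ := hpe
      rw [← hF, eq_comm, ← sub_eq_zero, he, ← mul_assoc, ← pow_two]
      have : ((p : ZMod (p ^ 2)) ^ 2) = 0 := by
        exact_mod_cast ZMod.natCast_self (p ^ 2)
      rw [this, zero_mul]
    obtain ⟨e', he'⟩ := heu.exists_left_inv
    refine hsub' (d * e') x y a b ?_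
    rw [hd, he]
    linear_combination (-(p : ZMod (p ^ 2)) * d) * he'
  · obtain ⟨x, y, rfl⟩ := S.exists_rel_eq_pair s
    obtain ⟨a, b, rfl⟩ := S.exists_rel_eq_pair v
    refine hc.absorbs (hker _) ?_
    rw [hU] at hv
    obtain ⟨e', he'⟩ := (isUnit_of_not_prime_dvd hp 2 hv).exists_left_inv
    refine hsub' ((F y - F x) * e') x y a b ?_
    linear_combination (-(F y - F x)) * he'

end Cases

end AssocScheme

theorem theorem1p1 (p : ℕ) (hp : p.Prime) (hodd : Odd p) {X : Type*} [Finite X]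
    (S : AssocScheme X) (hcomm : S.IsCommutative) (hpS : S.IsPScheme p)
    (hord : S.order Set.univ = p ^ 4)
    (h : (S.thinResidue = S.thinRadical ∧ S.order S.thinRadical = p ^ 2 ∧
            AssocScheme.Isomorphic (S.quotientRels S.thinResidue)
              (AssocScheme.cyclicRels (p ^ 2))) ∨
         (S.order S.thinRadical = p ^ 2 ∧ S.order S.thinResidue = p ^ 2 ∧
            S.thinResidue ≠ S.thinRadical ∧
            ∀ s : S.Rel, s ∉ S.complexMul S.thinRadical S.thinResidue → S.valency s = p ^ 2) ∨
         S.order S.thinRadical = p ^ 3) :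
    S.IsSchurian := by
  rcases h with ⟨h1, -, h3⟩ | ⟨h1, h2, h3, h4⟩ | h
  · exact hcomm.isSchurian_of_isomorphic_cyclicRels hp h1 h3
  · exact hcomm.isSchurian_of_thinResidue_ne_thinRadical hp hpS h1 h2 h3 h4
  · exact hcomm.isSchurian_of_order_thinRadical hp hpS hord h
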